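/- Let $n\in\mathbb N$, $1\le i\le n$, and let $e_i$ be the $i$-th unit vector of $\mathbb{R}^n$. For an open set $\Omega\subseteq\mathbb{R}^n$, let $W^{1,2}(\Omega)$ be the space of real-valued $u\in L^2(\Omega)$ all of whose first-order weak partial derivatives exist and belong to $L^2(\Omega)$; write $u_{x_i}=\partial u/\partial x_i$ for the weak partial derivative. For $h\in\mathbb{R}\setminus\{0\}$ let $$D^h_{x_i}u(x)=\frac{u(x+he_i)-u(x)}{h}$$ be the difference quotient. (1) If $u\in W^{1,2}(\mathbb{R}^n)$, then $\|D^h_{x_i}u\|_{L^2(\mathbb{R}^n)}\le\|u_{x_i}\|_{L^2(\mathbb{R}^n)}$ for every $h\neq0$, and $D^h_{x_i}u\to u_{x_i}$ in $L^2(\mathbb{R}^n)$ as $h\to0$. (2) Let $\Omega\subseteq\mathbb{R}^n$ be open and $u\in W^{1,2}(\Omega)$. For every $h\ne0$ let $\Omega_h$ be the set of all $x$ for which the segment $[x,x+he_i]$ lies in $\Omega$ (it contains every point of $\Omega$ at distance greater than $|h|$ from the complement of $\Omega$, hence every compact $K\subset\Omega$ whose distance from the complement of $\Omega$ is greater than $|h|$).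 Then $\|D^h_{x_i}u\|_{L^2(\Omega_h)}\le\|u_{x_i}\|_{L^2(\Omega)}$ for every $h\neq0$, and $D^h_{x_i}u\to u_{x_i}$ in $L^2(K)$ as $h\to0$ for every compact $K\subset\Omega$, i.e. in $L^2_{\mathrm{loc}}(\Omega)$. Moreover, for every sequence $h_k\to0$ of nonzero reals, $D^{h_k}_{x_i}u(x)\to u_{x_i}(x)$ for almost every $x\in\Omega$. -/

import Mathlib

open MeasureTheory Filter Topology TopologicalSpace
open scoped ENNReal

noncomputable section

/-- The unit vector `e_i` of `ℝⁿ`. -/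
def unitVec {n : ℕ} (i : Fin n) : EuclideanSpace ℝ (Fin n) :=
  EuclideanSpace.single i (1 : ℝ)

/-- The forward difference quotient `(u (x + h e_i) - u x) / h` (meaningful for `h ≠ 0`). -/
def diffQuot {n : ℕ} (i : Fin n) (h : ℝ) (u : EuclideanSpace ℝ (Fin n) → ℝ)
    (x : EuclideanSpace ℝ (Fin n)) : ℝ :=
  (u (x + h • unitVec i) - u x) / h

/-- `v` is a weak partial derivative `∂u/∂x_i` of `u` on the open set `Ω`: both functions are
locally integrable on `Ω`, and `∫_Ω u ∂_i φ = - ∫_Ω v φ` for all `φ ∈ C_c^∞(Ω)`. Values of `u`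
and `v` outside `Ω` are irrelevant. -/
structure IsWeakPartial {n : ℕ} (Ω : Opens (EuclideanSpace ℝ (Fin n))) (i : Fin n)
    (u v : EuclideanSpace ℝ (Fin n) → ℝ) : Prop where
  locInt_fun : LocallyIntegrableOn u (Ω : Set (EuclideanSpace ℝ (Fin n))) volume
  locInt_deriv : LocallyIntegrableOn v (Ω : Set (EuclideanSpace ℝ (Fin n))) volume
  integral_eq : ∀ φ : TestFunction Ω ℝ (⊤ : ℕ∞),
    ∫ x in (Ω : Set (EuclideanSpace ℝ (Fin n))), u x * fderiv ℝ φ x (unitVec i) =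
      - ∫ x in (Ω : Set (EuclideanSpace ℝ (Fin n))), v x * φ x

/-- `u ∈ W^{1,2}(Ω)`: `u ∈ L²(Ω)` has all first-order weak partial derivatives in `L²(Ω)`. -/
structure MemW12 {n : ℕ} (Ω : Opens (EuclideanSpace ℝ (Fin n)))
    (u : EuclideanSpace ℝ (Fin n) → ℝ) : Prop where
  memLp : MemLp u 2 (volume.restrict (Ω : Set (EuclideanSpace ℝ (Fin n))))
  exists_weakPartial : ∀ i : Fin n, ∃ v : EuclideanSpace ℝ (Fin n) → ℝ,
    IsWeakPartial Ω i u v ∧ MemLp v 2 (volume.restrict (Ω : Set (EuclideanSpace ℝ (Fin n))))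

/-- The set of the points `x` for which the whole segment `[x, x + h e_i]` lies in `Ω`. It contains
every point of `Ω` whose distance to the complement of `Ω` is larger than `|h|`. -/
def shiftDomain {n : ℕ} (Ω : Opens (EuclideanSpace ℝ (Fin n))) (i : Fin n) (h : ℝ) :
    Set (EuclideanSpace ℝ (Fin n)) :=
  {x | segment ℝ x (x + h • unitVec i) ⊆ (Ω : Set (EuclideanSpace ℝ (Fin n)))}

end

/-!
If `v` is a weak derivative of `u` in the direction `e`, then for almost every `x` the
increment `u (x + e) - u x` is the mean value of `v` over the segment `[x, x + e]`. Indeed,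
Fubini's theorem moves the mean value over segments from `u` to the test function, where the
fundamental theorem of calculus applies, and locally integrable functions with the same
integrals against all test functions agree almost everywhere. Hence the difference quotient
with step `h` is the mean value of `v` over `[x, x + h • e]`. Minkowski's integral inequality
and the invariance of the `L^p` norm under translations bound its norm by that of `v`, the
continuity of translations in `L^p` makes it converge to `v` in `L^p`, and Lebesgue's
differentiation theorem on almost every line parallel to `e` makes it converge almost
everywhere.
-/

section SegmentDomain

variable {E : Type*} [NormedAddCommGroup E] [NormedSpace ℝ E] {Ω : Set E} {e x : E}

/-- The set of the points `x` whose segment `[x, x + e]` lies in `Ω`. It is the domain on which the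
increment `u (x + e) - u x` of a function `u` on `Ω` is controlled by the derivative of `u`. -/
def segmentDomain (Ω : Set E) (e : E) : Set E :=
  {x | segment ℝ x (x + e) ⊆ Ω}

theorem mem_segmentDomain_iff :
    x ∈ segmentDomain Ω e ↔ ∀ s ∈ Set.Icc (0 : ℝ) 1, x + s • e ∈ Ω := by
  rw [segmentDomain, Set.mem_ofPred_eq, segment_eq_image', Set.image_subset_iff,
    add_sub_cancel_left]
  rfl

theorem segmentDomain_subset : segmentDomain Ω e ⊆ Ω :=
  fun x hx => hx (left_mem_segment ℝ x (x + e))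

theorem segmentDomain_univ : segmentDomain Set.univ e = Set.univ :=
  Set.eq_univ_of_forall fun _ => Set.subset_univ _

theorem isOpen_segmentDomain (hΩ : IsOpen Ω) (e : E) : IsOpen (segmentDomain Ω e) := by
  refine isOpen_iff_eventually.2 fun x hx => ?_
  simp only [mem_segmentDomain_iff] at hx ⊢
  refine isCompact_Icc.eventually_forall_of_forall_eventually fun s hs => ?_
  have hcont : Continuous fun z : E × ℝ => z.1 + z.2 • e := by fun_prop
  exact hcont.continuousAt.eventually_mem (hΩ.mem_nhds (hx s hs))

theorem eventually_subset_segmentDomain (hΩ : IsOpen Ω) {K : Set E} (hK : IsCompact K)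
    (hKΩ : K ⊆ Ω) : ∀ᶠ a in 𝓝 (0 : E), K ⊆ segmentDomain Ω a := by
  have h : ∀ᶠ a in 𝓝 (0 : E), ∀ z ∈ K ×ˢ Set.Icc (0 : ℝ) 1, z.1 + z.2 • a ∈ Ω := by
    refine (hK.prod isCompact_Icc).eventually_forall_of_forall_eventually fun z hz => ?_
    have hcont : Continuous fun w : E × (E × ℝ) => w.2.1 + w.2.2 • w.1 := by fun_prop
    exact hcont.continuousAt.eventually_mem (hΩ.mem_nhds (by simpa using hKΩ hz.1))
  filter_upwards [h] with a ha x hx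
  exact mem_segmentDomain_iff.2 fun s hs => ha (x, s) ⟨hx, hs⟩

theorem tendsto_smul_const_nhds_zero (e : E) : Tendsto (fun h : ℝ => h • e) (𝓝 0) (𝓝 0) :=
  Continuous.tendsto' (by fun_prop) 0 0 (zero_smul ℝ e)

theorem eventually_subset_segmentDomain_smul (hΩ : IsOpen Ω) {K : Set E} (hK : IsCompact K)
    (hKΩ : K ⊆ Ω) (e : E) : ∀ᶠ h in 𝓝 (0 : ℝ), K ⊆ segmentDomain Ω (h • e) :=
  (tendsto_smul_const_nhds_zero e).eventually (eventually_subset_segmentDomain hΩ hK hKΩ)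

end SegmentDomain

section SegmentAverage

variable {E F : Type*} [NormedAddCommGroup E] [NormedSpace ℝ E]
  [NormedAddCommGroup F] [NormedSpace ℝ F]

/-- The mean value of `W` over the segment `[x, x + e]`. A weak derivative of `u` in the direction
`e` has the mean value `u (x + e) - u x`, which is how difference quotients are controlled. -/
noncomputable def segmentAverage (W : E → F) (e x : E) : F :=
  ∫ s in Set.Icc (0 : ℝ) 1, W (x + s • e)

theorem segmentAverage_indicator {Ω : Set E} {W : E → F} {e x : E}
    (hx : x ∈ segmentDomain Ω e) :
    segmentAverage (Ω.indicator W) e x = segmentAverage W e x :=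
  setIntegral_congr_fun measurableSet_Icc fun s hs =>
    Set.indicator_of_mem (mem_segmentDomain_iff.1 hx s hs) W

theorem segmentAverage_smul_apply_add_smul (W : E → F) (e x : E) (r : ℝ) {h : ℝ} (hh : h ≠ 0) :
    segmentAverage W (h • e) (x + r • e) = h⁻¹ • ∫ t in r..r + h, W (x + t • e) := by
  have hsubst : ∫ s in (0 : ℝ)..1, W (x + (r + h * s) • e) =
      h⁻¹ • ∫ t in r..r + h, W (x + t • e) := by
    simpa using intervalIntegral.integral_comp_add_mul (a := 0) (b := 1)
      (fun t : ℝ => W (x + t • e)) hh r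
  rw [segmentAverage, integral_Icc_eq_integral_Ioc,
    ← intervalIntegral.integral_of_le zero_le_one, ← hsubst]
  congr 1 with s
  congr 1
  module

theorem segmentAverage_fderiv [CompleteSpace F] {g : E → F} (hg : ContDiff ℝ 1 g) (e x : E) :
    segmentAverage (fun y => fderiv ℝ g y e) e x = g (x + e) - g x := by
  have hderiv (s : ℝ) :
      HasDerivAt (fun s : ℝ => g (x + s • e)) (fderiv ℝ g (x + s • e) e) s := by
    have hline : HasDerivAt (fun s : ℝ => x + s • e) e s := by
      simpa using ((hasDerivAt_id s).smul_const e).const_add x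
    exact (hg.differentiable one_ne_zero _).hasFDerivAt.comp_hasDerivAt s hline
  have hcont : Continuous fun s : ℝ => fderiv ℝ g (x + s • e) e :=
    ((hg.continuous_fderiv one_ne_zero).comp (by fun_prop)).clm_apply continuous_const
  rw [segmentAverage, integral_Icc_eq_integral_Ioc, ← intervalIntegral.integral_of_le zero_le_one,
    intervalIntegral.integral_eq_sub_of_hasDerivAt (fun s _ => hderiv s)
      (hcont.intervalIntegrable 0 1)]
  simp

theorem ae_tendsto_segmentAverage_on_line [CompleteSpace F] {W : E → F} {x e : E}
    (hx : LocallyIntegrable fun t : ℝ => W (x + t • e)) :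
    ∀ᵐ r : ℝ, Tendsto (fun h : ℝ => segmentAverage W (h • e) (x + r • e)) (𝓝[≠] 0)
      (𝓝 (W (x + r • e))) := by
  filter_upwards [LocallyIntegrable.ae_hasDerivAt_integral hx] with r hr
  refine (hasDerivAt_iff_tendsto_slope_zero.1 (hr r)).congr' ?_
  filter_upwards [self_mem_nhdsWithin] with h hh
  simp [segmentAverage_smul_apply_add_smul W e x r hh]

theorem stronglyMeasurable_segmentAverage [MeasurableSpace E] [BorelSpace E] {W : E → F}
    (hW : StronglyMeasurable W) (e : E) : StronglyMeasurable (segmentAverage W e) := by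
  have hline : Measurable fun z : E × ℝ => z.1 + z.2 • e :=
    Continuous.measurable (by fun_prop)
  have hcomp : StronglyMeasurable (Function.uncurry fun (x : E) (s : ℝ) => W (x + s • e)) :=
    hW.comp_measurable hline
  exact hcomp.integral_prod_right (ν := volume.restrict (Set.Icc 0 1))

end SegmentAverage

section Shear

theorem integrable_smul_of_integrableOn_of_support_subset {α F : Type*} [MeasurableSpace α]
    {μ : Measure α} [NormedAddCommGroup F] [NormedSpace ℝ F] {g : α → ℝ} {f : α → F} {S : Set α}
    {C : ℝ} (hg : AEStronglyMeasurable g μ) (hC : ∀ x, ‖g x‖ ≤ C) (hS : Function.support g ⊆ S)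
    (hf : IntegrableOn f S μ) : Integrable (fun x => g x • f x) μ :=
  (integrableOn_iff_integrable_of_support_subset fun _ hx => hS (left_ne_zero_of_smul hx)).1
    (hf.bdd_smul C hg.restrict (ae_of_all _ hC))

variable {E F : Type*} [NormedAddCommGroup E] [NormedSpace ℝ E] [FiniteDimensional ℝ E]
  [MeasurableSpace E] [BorelSpace E] {μ : Measure E} [μ.IsAddHaarMeasure]
  [NormedAddCommGroup F]

theorem measurePreserving_shear (ν : Measure ℝ) [SFinite ν] (e : E) :
    MeasurePreserving (fun z : ℝ × E => (z.1, z.2 + z.1 • e)) (ν.prod μ) (ν.prod μ) :=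
  (MeasurePreserving.id ν).skew_product (g := fun (s : ℝ) (x : E) => x + s • e)
    (Continuous.measurable (by fun_prop))
    (ae_of_all _ fun s => (measurePreserving_add_right μ (s • e)).map_eq)

theorem aestronglyMeasurable_comp_shear {W : E → F} (hW : AEStronglyMeasurable W μ) (e : E)
    (ν : Measure ℝ) [SFinite ν] :
    AEStronglyMeasurable (fun z : ℝ × E => W (z.2 + z.1 • e)) (ν.prod μ) :=
  hW.comp_snd.comp_measurePreserving (measurePreserving_shear ν e)

variable {Ω K : Set E} {I : Set ℝ} {W : E → F} {e : E}

theorem integrable_comp_shear (hW : LocallyIntegrableOn W Ω μ) (hI : IsCompact I)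
    (hK : IsCompact K) (hIK : ∀ x ∈ K, ∀ s ∈ I, x + s • e ∈ Ω) :
    Integrable (fun z : ℝ × E => W (z.2 + z.1 • e)) ((volume.restrict I).prod (μ.restrict K)) := by
  have : IsFiniteMeasure (volume.restrict I) := ⟨by simpa using hI.measure_lt_top⟩
  set C : Set E := (fun z : ℝ × E => z.2 + z.1 • e) '' (I ×ˢ K)
  have hC : IsCompact C := (hI.prod hK).image (by fun_prop)
  have hCΩ : C ⊆ Ω := by
    rintro _ ⟨z, hz, rfl⟩
    exact hIK z.2 hz.2 z.1 hz.1
  have hWC : Integrable (C.indicator W) μ :=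
    (hW.integrableOn_compact_subset hCΩ hC).integrable_indicator hC.measurableSet
  have hshear : Integrable (fun z : ℝ × E => C.indicator W (z.2 + z.1 • e))
      ((volume.restrict I).prod μ) :=
    (measurePreserving_shear _ e).integrable_comp_of_integrable (hWC.comp_snd _)
  refine (hshear.mono_measure (Measure.prod_mono le_rfl Measure.restrict_le_self)).congr ?_
  rw [Measure.prod_restrict]
  filter_upwards [ae_restrict_mem (hI.measurableSet.prod hK.measurableSet)] with z hz
  exact Set.indicator_of_mem (Set.mem_image_of_mem _ hz) _

theorem integrable_smul_comp_shear [NormedSpace ℝ F] {g : E → ℝ} (hg : Continuous g)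
    (hgc : HasCompactSupport g) (hW : LocallyIntegrableOn W Ω μ) (hI : IsCompact I)
    (hIg : ∀ x ∈ tsupport g, ∀ s ∈ I, x + s • e ∈ Ω) :
    Integrable (fun z : ℝ × E => g z.2 • W (z.2 + z.1 • e)) ((volume.restrict I).prod μ) := by
  obtain ⟨C, hC⟩ := hg.bounded_above_of_compact_support hgc
  have hshear := integrable_comp_shear hW hI hgc.isCompact hIg
  rw [← Measure.restrict_univ (μ := volume.restrict I), Measure.prod_restrict] at hshear
  exact integrable_smul_of_integrableOn_of_support_subset (g := fun z : ℝ × E => g z.2)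
    (hg.comp continuous_snd).aestronglyMeasurable (fun z => hC z.2)
    (fun z hz => Set.mk_mem_prod (Set.mem_univ z.1) (subset_tsupport g hz)) hshear

theorem ae_locallyIntegrable_line (hW : LocallyIntegrable W μ) (e : E) :
    ∀ᵐ x ∂μ, LocallyIntegrable (fun t : ℝ => W (x + t • e)) := by
  have hball (N : ℕ) : ∀ᵐ x ∂μ, x ∈ Metric.closedBall (0 : E) N →
      IntegrableOn (fun t : ℝ => W (x + t • e)) (Metric.closedBall (0 : ℝ) N) :=
    (ae_restrict_iff' measurableSet_closedBall).1
      (integrable_comp_shear (hW.locallyIntegrableOn Set.univ) (isCompact_closedBall (0 : ℝ) N)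
        (isCompact_closedBall (0 : E) N) fun _ _ _ _ => Set.mem_univ _).prod_left_ae
  filter_upwards [ae_all_iff.2 hball] with x hx
  refine locallyIntegrable_iff.2 fun k hk => ?_
  obtain ⟨R, hR⟩ := hk.isBounded.subset_closedBall 0
  obtain ⟨N, hN⟩ := exists_nat_ge (max R ‖x‖)
  have hxN : x ∈ Metric.closedBall (0 : E) N := by simpa using (le_max_right _ _).trans hN
  exact (hx N hxN).mono_set
    (hR.trans (Metric.closedBall_subset_closedBall ((le_max_left _ _).trans hN)))

theorem segmentAverage_ae_congr [NormedSpace ℝ F] {W W' : E → F} (h : W =ᵐ[μ] W') (e : E) :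
    segmentAverage W e =ᵐ[μ] segmentAverage W' e := by
  have hshear : ∀ᵐ z ∂(volume.restrict (Set.Icc (0 : ℝ) 1)).prod μ,
      W (z.2 + z.1 • e) = W' (z.2 + z.1 • e) :=
    (measurePreserving_shear _ e).quasiMeasurePreserving.ae
      (Measure.quasiMeasurePreserving_snd.ae h)
  filter_upwards [Measure.ae_ae_of_ae_prod
    (Measure.measurePreserving_swap.quasiMeasurePreserving.ae hshear)] with x hx
  exact integral_congr_ae hx

theorem locallyIntegrableOn_segmentAverage [NormedSpace ℝ F] (hΩ : IsOpen Ω)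
    (hW : LocallyIntegrableOn W Ω μ) (e : E) :
    LocallyIntegrableOn (segmentAverage W e) (segmentDomain Ω e) μ := by
  refine (locallyIntegrableOn_iff (isOpen_segmentDomain hΩ e).isLocallyClosed).2 fun K hK hKc => ?_
  exact (integrable_comp_shear hW isCompact_Icc hKc
    fun x hx => mem_segmentDomain_iff.1 (hK hx)).integral_prod_right

end Shear

section Lp

theorem enorm_integral_rpow_le {α F : Type*} [MeasurableSpace α] [NormedAddCommGroup F]
    [NormedSpace ℝ F] {ν : Measure α} [IsProbabilityMeasure ν] {f : α → F}
    (hf : AEStronglyMeasurable f ν) {q : NNReal} (hq : 1 ≤ q) :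
    ‖∫ s, f s ∂ν‖ₑ ^ (q : ℝ) ≤ ∫⁻ s, ‖f s‖ₑ ^ (q : ℝ) ∂ν := by
  rw [← eLpNorm_nnreal_pow_eq_lintegral (zero_lt_one.trans_le hq).ne']
  gcongr
  calc ‖∫ s, f s ∂ν‖ₑ ≤ ∫⁻ s, ‖f s‖ₑ ∂ν := enorm_integral_le_lintegral_enorm _
    _ = eLpNorm f 1 ν := eLpNorm_one_eq_lintegral_enorm.symm
    _ ≤ eLpNorm f q ν := eLpNorm_le_eLpNorm_of_exponent_le (by exact_mod_cast hq) hf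

theorem ae_lintegral_tsub_eq_zero {α β : Type*} [MeasurableSpace α] [MeasurableSpace β]
    {ν : Measure α} {μ : Measure β} [SFinite ν] [SFinite μ] {f : α → β → ℝ≥0∞}
    (hf : AEMeasurable (Function.uncurry f) (ν.prod μ)) {C : ℝ≥0∞}
    (hC : ∀ᵐ s ∂ν, ∀ᵐ x ∂μ, f s x ≤ C) :
    ∀ᵐ x ∂μ, ∫⁻ s, (f s x - C) ∂ν = 0 := by
  have hsub : AEMeasurable (Function.uncurry fun s x => f s x - C) (ν.prod μ) :=
    hf.sub_const C
  have hzero : ∫⁻ x, ∫⁻ s, (f s x - C) ∂ν ∂μ = 0 := by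
    rw [← lintegral_lintegral_swap hsub]
    refine lintegral_eq_zero_of_ae_eq_zero ?_
    filter_upwards [hC] with s hs
    refine lintegral_eq_zero_of_ae_eq_zero ?_
    filter_upwards [hs] with x hx using tsub_eq_zero_of_le hx
  exact (lintegral_eq_zero_iff' hsub.prod_swap.lintegral_prod_right').1 hzero

theorem eLpNorm_integral_le {α β F : Type*} [MeasurableSpace α] [MeasurableSpace β]
    [NormedAddCommGroup F] [NormedSpace ℝ F] {ν : Measure α} {μ : Measure β}
    [IsProbabilityMeasure ν] [SFinite μ] {f : α → β → F}
    (hf : AEStronglyMeasurable (Function.uncurry f) (ν.prod μ)) {p : ℝ≥0∞} (hp : 1 ≤ p)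
    {C : ℝ≥0∞} (hC : ∀ᵐ s ∂ν, eLpNorm (f s) p μ ≤ C) :
    eLpNorm (fun x => ∫ s, f s x ∂ν) p μ ≤ C := by
  obtain rfl | hp_top := eq_or_ne p ∞
  · simp only [eLpNorm_exponent_top] at hC ⊢
    have hbound : ∀ᵐ s ∂ν, ∀ᵐ x ∂μ, ‖f s x‖ₑ ≤ C := hC.mono fun s hs =>
      (enorm_ae_le_eLpNormEssSup _ _).mono fun x hx => hx.trans hs
    refine eLpNormEssSup_le_of_ae_enorm_bound ?_
    filter_upwards [ae_lintegral_tsub_eq_zero hf.enorm hbound] with x hx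
    calc ‖∫ s, f s x ∂ν‖ₑ ≤ ∫⁻ s, ‖f s x‖ₑ ∂ν := enorm_integral_le_lintegral_enorm _
      _ ≤ ∫⁻ s, (‖f s x‖ₑ - C + C) ∂ν := lintegral_mono fun s => le_tsub_add
      _ = C := by rw [lintegral_add_right _ measurable_const, hx]; simp
  lift p to NNReal using hp_top
  have hp1 : 1 ≤ p := by exact_mod_cast hp
  have hp0 : p ≠ 0 := (zero_lt_one.trans_le hp1).ne'
  have hpow : AEMeasurable (Function.uncurry fun s x => ‖f s x‖ₑ ^ (p : ℝ)) (ν.prod μ) :=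
    hf.enorm.pow_const _
  have hsection : ∀ᵐ x ∂μ, AEStronglyMeasurable (fun s => f s x) ν := hf.prod_swap.prodMk_left
  refine (ENNReal.rpow_le_rpow_iff (NNReal.coe_pos.2 hp0.bot_lt)).1 ?_
  calc eLpNorm (fun x => ∫ s, f s x ∂ν) p μ ^ (p : ℝ)
      = ∫⁻ x, ‖∫ s, f s x ∂ν‖ₑ ^ (p : ℝ) ∂μ := eLpNorm_nnreal_pow_eq_lintegral hp0
    _ ≤ ∫⁻ x, ∫⁻ s, ‖f s x‖ₑ ^ (p : ℝ) ∂ν ∂μ :=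
        lintegral_mono_ae (hsection.mono fun x hx => enorm_integral_rpow_le hx hp1)
    _ = ∫⁻ s, ∫⁻ x, ‖f s x‖ₑ ^ (p : ℝ) ∂μ ∂ν := (lintegral_lintegral_swap hpow).symm
    _ = ∫⁻ s, eLpNorm (f s) p μ ^ (p : ℝ) ∂ν := by simp only [eLpNorm_nnreal_pow_eq_lintegral hp0]
    _ ≤ ∫⁻ _, C ^ (p : ℝ) ∂ν := lintegral_mono_ae (hC.mono fun s hs => by gcongr)
    _ = C ^ (p : ℝ) := by simp

variable {E F : Type*} [NormedAddCommGroup E] [NormedSpace ℝ E] [FiniteDimensional ℝ E]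
  [MeasurableSpace E] [BorelSpace E] {μ : Measure E} [μ.IsAddHaarMeasure]
  [NormedAddCommGroup F] {W : E → F} {p : ℝ≥0∞}

theorem tendsto_eLpNorm_translate_sub (hW : MemLp W p μ) (hp : 1 ≤ p) (hp_top : p ≠ ∞) :
    Tendsto (fun a : E => eLpNorm (fun x => W (x + a) - W x) p μ) (𝓝 0) (𝓝 0) := by
  have : Fact (1 ≤ p) := ⟨hp⟩
  let τ : E → C(E, E) := fun a => ⟨fun x => x + a, continuous_add_const a⟩
  have hτ : Continuous τ := ContinuousMap.continuous_of_continuous_uncurry _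
    (continuous_snd.add continuous_fst)
  have hτμ (a : E) : MeasurePreserving (τ a) μ μ := measurePreserving_add_right μ a
  have hlim := (tendsto_const_nhds (x := hW.toLp W) (f := 𝓝 (0 : E))).compMeasurePreservingLp
    (hτ.tendsto 0) hτμ (hτμ 0) hp_top
  refine (tendsto_iff_edist_tendsto_0.1 hlim).congr fun a => ?_
  simp only [Lp.toLp_compMeasurePreserving, Lp.edist_toLp_toLp]
  congr 1 with x
  simp [τ]

variable [NormedSpace ℝ F] {Ω : Set E}

instance isProbabilityMeasure_restrict_Icc_zero_one :
    IsProbabilityMeasure ((volume : Measure ℝ).restrict (Set.Icc 0 1)) :=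
  ⟨by simp⟩

theorem eLpNorm_segmentAverage_le (hW : AEStronglyMeasurable W μ) (hp : 1 ≤ p) (e : E) :
    eLpNorm (segmentAverage W e) p μ ≤ eLpNorm W p μ :=
  eLpNorm_integral_le (f := fun s x => W (x + s • e)) (aestronglyMeasurable_comp_shear hW e _) hp
    (ae_of_all _ fun s =>
      (eLpNorm_comp_measurePreserving hW (measurePreserving_add_right μ (s • e))).le)

theorem eLpNorm_restrict_segmentAverage_le (hΩ : IsOpen Ω)
    (hW : AEStronglyMeasurable W (μ.restrict Ω)) (hp : 1 ≤ p) (e : E) :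
    eLpNorm (segmentAverage W e) p (μ.restrict (segmentDomain Ω e)) ≤
      eLpNorm W p (μ.restrict Ω) := by
  have hD := (isOpen_segmentDomain hΩ e).measurableSet
  calc eLpNorm (segmentAverage W e) p (μ.restrict (segmentDomain Ω e))
      = eLpNorm (segmentAverage (Ω.indicator W) e) p (μ.restrict (segmentDomain Ω e)) :=
        eLpNorm_congr_ae
          (ae_restrict_of_forall_mem hD fun _ hx => (segmentAverage_indicator hx).symm)
    _ ≤ eLpNorm (segmentAverage (Ω.indicator W) e) p μ :=
        eLpNorm_mono_measure _ Measure.restrict_le_self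
    _ ≤ eLpNorm (Ω.indicator W) p μ :=
        eLpNorm_segmentAverage_le ((aestronglyMeasurable_indicator_iff hΩ.measurableSet).2 hW) hp e
    _ = eLpNorm W p (μ.restrict Ω) := eLpNorm_indicator_eq_eLpNorm_restrict hΩ.measurableSet

theorem segmentAverage_sub_ae_eq [CompleteSpace F] (hW : LocallyIntegrable W μ) (e : E) :
    (fun x => segmentAverage W e x - W x) =ᵐ[μ]
      fun x => ∫ s in Set.Icc (0 : ℝ) 1, (W (x + s • e) - W x) := by
  filter_upwards [ae_locallyIntegrable_line hW e] with x hx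
  rw [integral_sub (hx.integrableOn_isCompact isCompact_Icc) (integrable_const _)]
  simp [segmentAverage]

theorem tendsto_eLpNorm_segmentAverage_sub [CompleteSpace F] (hW : MemLp W p μ) (hp : 1 ≤ p)
    (hp_top : p ≠ ∞) :
    Tendsto (fun e : E => eLpNorm (fun x => segmentAverage W e x - W x) p μ) (𝓝 0) (𝓝 0) := by
  refine ENNReal.tendsto_nhds_zero.2 fun ε hε => ?_
  obtain ⟨δ, hδ, htranslate⟩ := Metric.eventually_nhds_iff_ball.1
    (ENNReal.tendsto_nhds_zero.1 (tendsto_eLpNorm_translate_sub hW hp hp_top) ε hε)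
  filter_upwards [Metric.ball_mem_nhds (0 : E) hδ] with e he
  rw [eLpNorm_congr_ae (segmentAverage_sub_ae_eq (hW.locallyIntegrable hp) e)]
  refine eLpNorm_integral_le (f := fun s x => W (x + s • e) - W x)
    ((aestronglyMeasurable_comp_shear hW.1 e _).sub hW.1.comp_snd) hp ?_
  filter_upwards [ae_restrict_mem measurableSet_Icc] with s hs
  refine htranslate (s • e) (mem_ball_zero_iff.2 ?_)
  rw [norm_smul, Real.norm_of_nonneg hs.1]
  exact (mul_le_of_le_one_left (norm_nonneg e) hs.2).trans_lt (mem_ball_zero_iff.1 he)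

theorem tendsto_eLpNorm_restrict_segmentAverage_sub [CompleteSpace F] (hΩ : IsOpen Ω)
    (hW : MemLp W p (μ.restrict Ω)) (hp : 1 ≤ p) (hp_top : p ≠ ∞) :
    Tendsto (fun e : E => eLpNorm (fun x => segmentAverage W e x - W x) p
      (μ.restrict (segmentDomain Ω e))) (𝓝 0) (𝓝 0) := by
  have hindicator : MemLp (Ω.indicator W) p μ :=
    (memLp_indicator_iff_restrict hΩ.measurableSet).2 hW
  refine tendsto_of_tendsto_of_tendsto_of_le_of_le tendsto_const_nhds
    (tendsto_eLpNorm_segmentAverage_sub hindicator hp hp_top) (fun _ => zero_le) fun e => ?_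
  have hcongr : ∀ᵐ x ∂μ.restrict (segmentDomain Ω e), segmentAverage W e x - W x =
      segmentAverage (Ω.indicator W) e x - Ω.indicator W x :=
    ae_restrict_of_forall_mem (isOpen_segmentDomain hΩ e).measurableSet fun x hx => by
      rw [segmentAverage_indicator hx, Set.indicator_of_mem (segmentDomain_subset hx)]
  rw [eLpNorm_congr_ae hcongr]
  exact eLpNorm_mono_measure _ Measure.restrict_le_self

end Lp

section AeConvergence

theorem measurableSet_tendsto_of_stronglyMeasurable {α F : Type*} [MeasurableSpace α]
    [NormedAddCommGroup F] {f : ℕ → α → F} {g : α → F} (hf : ∀ k, StronglyMeasurable (f k))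
    (hg : StronglyMeasurable g) :
    MeasurableSet {x | Tendsto (fun k => f k x) atTop (𝓝 (g x))} := by
  have hiff (x : α) : Tendsto (fun k => f k x) atTop (𝓝 (g x)) ↔
      Tendsto (fun k => ‖f k x - g x‖) atTop (𝓝 0) := tendsto_iff_norm_sub_tendsto_zero
  simp only [hiff]
  exact measurableSet_tendsto_fun (fun k => ((hf k).sub hg).norm.measurable) measurable_const

variable {E F : Type*} [NormedAddCommGroup E] [NormedSpace ℝ E] [FiniteDimensional ℝ E]
  [MeasurableSpace E] [BorelSpace E] {μ : Measure E} [μ.IsAddHaarMeasure]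
  [NormedAddCommGroup F] [NormedSpace ℝ F] [CompleteSpace F] {W : E → F} {h : ℕ → ℝ}

theorem ae_of_ae_ae_line {S : Set E} (hS : MeasurableSet S) (e : E)
    (h : ∀ᵐ x ∂μ, ∀ᵐ r : ℝ, x + r • e ∈ S) : ∀ᵐ x ∂μ, x ∈ S := by
  have hpre : MeasurableSet {z : E × ℝ | z.1 + z.2 • e ∈ S} :=
    hS.preimage (f := fun z : E × ℝ => z.1 + z.2 • e) (Continuous.measurable (by fun_prop))
  obtain ⟨r, hr⟩ := ((Measure.ae_ae_comm hpre).1 h).exists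
  filter_upwards [(measurePreserving_sub_right μ (r • e)).quasiMeasurePreserving.ae hr] with x hx
  simpa using hx

theorem ae_tendsto_segmentAverage_of_stronglyMeasurable (hWm : StronglyMeasurable W)
    (hW : LocallyIntegrable W μ) (e : E) (hh : Tendsto h atTop (𝓝[≠] 0)) :
    ∀ᵐ x ∂μ, Tendsto (fun k => segmentAverage W (h k • e) x) atTop (𝓝 (W x)) := by
  refine ae_of_ae_ae_line (measurableSet_tendsto_of_stronglyMeasurable
    (fun k => stronglyMeasurable_segmentAverage hWm _) hWm) e ?_
  filter_upwards [ae_locallyIntegrable_line hW e] with x hx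
  exact (ae_tendsto_segmentAverage_on_line hx).mono fun r hr => hr.comp hh

theorem ae_tendsto_segmentAverage (hW : LocallyIntegrable W μ) (e : E)
    (hh : Tendsto h atTop (𝓝[≠] 0)) :
    ∀ᵐ x ∂μ, Tendsto (fun k => segmentAverage W (h k • e) x) atTop (𝓝 (W x)) := by
  have hmk := hW.aestronglyMeasurable.ae_eq_mk
  have hcongr := ae_all_iff.2 fun k => segmentAverage_ae_congr hmk (h k • e)
  filter_upwards [hmk, hcongr, ae_tendsto_segmentAverage_of_stronglyMeasurable
    hW.aestronglyMeasurable.stronglyMeasurable_mk (hW.congr hmk) e hh] with x hx hxk hlim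
  simpa only [hx, hxk] using hlim

theorem ae_restrict_tendsto_segmentAverage {Ω : Set E} (hΩ : IsOpen Ω)
    (hW : LocallyIntegrableOn W Ω μ) (e : E) (hh : Tendsto h atTop (𝓝[≠] 0)) :
    ∀ᵐ x ∂μ.restrict Ω, Tendsto (fun k => segmentAverage W (h k • e) x) atTop (𝓝 (W x)) := by
  obtain ⟨V, hV, hΩV, hint⟩ := hW.exists_nat_integrableOn
  have hopen (j : ℕ) : IsOpen (V j ∩ Ω) := (hV j).inter hΩ
  have hlim (j : ℕ) := ae_tendsto_segmentAverage
    ((hint j).integrable_indicator (hopen j).measurableSet).locallyIntegrable e hh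
  refine (ae_restrict_iff' hΩ.measurableSet).2 ?_
  filter_upwards [ae_all_iff.2 hlim] with x hx hxΩ
  obtain ⟨j, hj⟩ := Set.mem_iUnion.1 (hΩV hxΩ)
  have hxj : x ∈ V j ∩ Ω := ⟨hj, hxΩ⟩
  have hsegment := (hh.mono_right nhdsWithin_le_nhds).eventually
    (eventually_subset_segmentDomain_smul (hopen j) isCompact_singleton
      (Set.singleton_subset_iff.2 hxj) e)
  have hxlim := hx j
  rw [Set.indicator_of_mem hxj] at hxlim
  exact hxlim.congr' (hsegment.mono fun k hk => segmentAverage_indicator (hk rfl))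

end AeConvergence

section LocallyIntegrable

variable {E F : Type*} [NormedAddCommGroup E] [NormedAddCommGroup F] {Ω : Set E}

theorem tsupport_comp_sub_right_subset {g : E → ℝ} {a : E} (hg : tsupport g ⊆ (· + a) ⁻¹' Ω) :
    tsupport (fun x => g (x - a)) ⊆ Ω := fun x hx => by
  simpa using hg (tsupport_comp_subset_preimage g (continuous_sub_right a) hx)

variable [MeasurableSpace E] [BorelSpace E] {μ : Measure E} {u : E → F}

theorem integrable_smul_of_tsupport_subset [NormedSpace ℝ F] {g : E → ℝ} (hg : Continuous g)
    (hgc : HasCompactSupport g) (hgΩ : tsupport g ⊆ Ω) (hu : LocallyIntegrableOn u Ω μ) :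
    Integrable (fun x => g x • u x) μ := by
  obtain ⟨C, hC⟩ := hg.bounded_above_of_compact_support hgc
  exact integrable_smul_of_integrableOn_of_support_subset hg.aestronglyMeasurable hC
    (subset_tsupport g) (hu.integrableOn_compact_subset hgΩ hgc.isCompact)

theorem locallyIntegrableOn_comp_add_right [NormedSpace ℝ E] [FiniteDimensional ℝ E]
    [μ.IsAddHaarMeasure] (hΩ : IsOpen Ω) (hu : LocallyIntegrableOn u Ω μ) (a : E) :
    LocallyIntegrableOn (fun x => u (x + a)) ((· + a) ⁻¹' Ω) μ := by
  have hopen : IsOpen ((· + a) ⁻¹' Ω) := hΩ.preimage (continuous_add_const a)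
  refine (locallyIntegrableOn_iff hopen.isLocallyClosed).2 fun K hKΩ hK => ?_
  exact ((measurePreserving_add_right μ a).integrableOn_image
    (Homeomorph.addRight a).measurableEmbedding).1
    (hu.integrableOn_compact_subset (Set.image_subset_iff.2 hKΩ)
      (hK.image (continuous_add_const a)))

end LocallyIntegrable

section WeakDerivative

variable {E F : Type*} [NormedAddCommGroup E] [NormedSpace ℝ E] [MeasurableSpace E]
  [NormedAddCommGroup F] [NormedSpace ℝ F] {μ : Measure E} {Ω : Set E} {u v w : E → F} {e : E}

/-- `v` is a weak derivative of `u` in the direction `e` on the open set `Ω`. The integrals are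
taken over the whole space, as the test functions vanish outside `Ω`. -/
structure HasWeakLineDerivOn (u v : E → F) (e : E) (Ω : Set E) (μ : Measure E) : Prop where
  locInt_fun : LocallyIntegrableOn u Ω μ
  locInt_deriv : LocallyIntegrableOn v Ω μ
  integral_eq : ∀ φ : E → ℝ, ContDiff ℝ (⊤ : ℕ∞) φ → HasCompactSupport φ → tsupport φ ⊆ Ω →
    ∫ x, fderiv ℝ φ x e • u x ∂μ = -∫ x, φ x • v x ∂μ

theorem HasWeakLineDerivOn.smul_direction (huv : HasWeakLineDerivOn u v e Ω μ) (c : ℝ) :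
    HasWeakLineDerivOn u (fun x => c • v x) (c • e) Ω μ where
  locInt_fun := huv.locInt_fun
  locInt_deriv := huv.locInt_deriv.smul c
  integral_eq φ hφ hφc hφΩ := by
    simp only [map_smul, smul_assoc, smul_comm (φ _) c, integral_smul,
      huv.integral_eq φ hφ hφc hφΩ, smul_neg]

variable [BorelSpace E] [FiniteDimensional ℝ E]

theorem ae_restrict_eq_of_forall_integral_smul_eq [CompleteSpace F] (hΩ : IsOpen Ω)
    (hu : LocallyIntegrableOn u Ω μ) (hv : LocallyIntegrableOn v Ω μ)
    (huv : ∀ φ : E → ℝ, ContDiff ℝ (⊤ : ℕ∞) φ → HasCompactSupport φ → tsupport φ ⊆ Ω →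
      ∫ x, φ x • u x ∂μ = ∫ x, φ x • v x ∂μ) :
    u =ᵐ[μ.restrict Ω] v := by
  have hsub : ∀ᵐ x ∂μ, x ∈ Ω → (u - v) x = 0 := by
    refine hΩ.ae_eq_zero_of_integral_contDiff_smul_eq_zero (hu.sub hv) fun φ hφ hφc hφΩ => ?_
    simp only [Pi.sub_apply, smul_sub]
    rw [integral_sub (integrable_smul_of_tsupport_subset hφ.continuous hφc hφΩ hu)
      (integrable_smul_of_tsupport_subset hφ.continuous hφc hφΩ hv), huv φ hφ hφc hφΩ, sub_self]
  refine (ae_restrict_iff' hΩ.measurableSet).2 (hsub.mono fun x hx hxΩ => ?_)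
  exact sub_eq_zero.1 (hx hxΩ)

theorem HasWeakLineDerivOn.ae_eq [CompleteSpace F] (hΩ : IsOpen Ω)
    (hv : HasWeakLineDerivOn u v e Ω μ) (hw : HasWeakLineDerivOn u w e Ω μ) :
    v =ᵐ[μ.restrict Ω] w :=
  ae_restrict_eq_of_forall_integral_smul_eq hΩ hv.locInt_deriv hw.locInt_deriv
    fun φ hφ hφc hφΩ => neg_injective <|
      (hv.integral_eq φ hφ hφc hφΩ).symm.trans (hw.integral_eq φ hφ hφc hφΩ)

variable [μ.IsAddHaarMeasure]

theorem HasWeakLineDerivOn.comp_add_right (hΩ : IsOpen Ω) (huv : HasWeakLineDerivOn u v e Ω μ)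
    (a : E) :
    HasWeakLineDerivOn (fun x => u (x + a)) (fun x => v (x + a)) e ((· + a) ⁻¹' Ω) μ where
  locInt_fun := locallyIntegrableOn_comp_add_right hΩ huv.locInt_fun a
  locInt_deriv := locallyIntegrableOn_comp_add_right hΩ huv.locInt_deriv a
  integral_eq φ hφ hφc hφΩ := by
    have hshift := huv.integral_eq (fun x => φ (x - a)) (hφ.comp (by fun_prop))
      (hφc.comp_homeomorph (Homeomorph.subRight a)) (tsupport_comp_sub_right_subset hφΩ)
    rw [← integral_sub_right_eq_self _ a, ← integral_sub_right_eq_self (fun x => φ x • v (x + a)) a]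
    simpa [fderiv_comp_sub] using hshift

variable {g : E → ℝ}

theorem integral_smul_segmentAverage_eq_integral_integral (hg : Continuous g)
    (hgc : HasCompactSupport g) (hge : tsupport g ⊆ segmentDomain Ω e)
    (hu : LocallyIntegrableOn u Ω μ) :
    ∫ x, g x • segmentAverage u e x ∂μ =
      ∫ s in Set.Icc (0 : ℝ) 1, ∫ x, g x • u (x + s • e) ∂μ := by
  rw [integral_integral_swap (integrable_smul_comp_shear hg hgc hu isCompact_Icc
    fun x hx => mem_segmentDomain_iff.1 (hge hx))]
  simp only [segmentAverage, integral_smul]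

theorem integral_smul_segmentAverage_eq_integral_segmentAverage_neg_smul [CompleteSpace F]
    (hg : Continuous g) (hgc : HasCompactSupport g) (hge : tsupport g ⊆ segmentDomain Ω e)
    (hu : LocallyIntegrableOn u Ω μ) :
    ∫ x, g x • segmentAverage u e x ∂μ = ∫ y, segmentAverage g (-e) y • u y ∂μ := by
  have hshear : Integrable (fun z : ℝ × E => g (z.2 + z.1 • -e) • u z.2)
      ((volume.restrict (Set.Icc (0 : ℝ) 1)).prod μ) := by
    have := (measurePreserving_shear (volume.restrict (Set.Icc (0 : ℝ) 1))
      (-e)).integrable_comp_of_integrable (integrable_smul_comp_shear hg hgc hu isCompact_Icc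
        fun x hx => mem_segmentDomain_iff.1 (hge hx))
    simpa [Function.comp_def] using this
  calc ∫ x, g x • segmentAverage u e x ∂μ
      = ∫ s in Set.Icc (0 : ℝ) 1, ∫ x, g x • u (x + s • e) ∂μ :=
        integral_smul_segmentAverage_eq_integral_integral hg hgc hge hu
    _ = ∫ s in Set.Icc (0 : ℝ) 1, ∫ y, g (y + s • -e) • u y ∂μ := by
        congr 1 with s
        rw [← integral_sub_right_eq_self _ (s • e)]
        simp [sub_eq_add_neg]
    _ = ∫ y, (∫ s in Set.Icc (0 : ℝ) 1, g (y + s • -e) • u y) ∂μ :=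
        integral_integral_swap hshear
    _ = ∫ y, segmentAverage g (-e) y • u y ∂μ := by
        simp only [integral_smul_const, segmentAverage]

theorem integral_smul_increment_eq_neg_integral_fderiv_smul [CompleteSpace F] (hΩ : IsOpen Ω)
    (hu : LocallyIntegrableOn u Ω μ) (hg : ContDiff ℝ 1 g) (hgc : HasCompactSupport g)
    (hge : tsupport g ⊆ segmentDomain Ω e) :
    ∫ x, g x • (u (x + e) - u x) ∂μ =
      -∫ x, fderiv ℝ g x e • segmentAverage u e x ∂μ := by
  have hendpoint : tsupport g ⊆ (· + e) ⁻¹' Ω := fun x hx => hge hx (right_mem_segment ℝ x _)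
  have hintegrable := integrable_smul_of_tsupport_subset hg.continuous hgc
    (hge.trans segmentDomain_subset) hu
  have hintegrable_add := integrable_smul_of_tsupport_subset hg.continuous hgc hendpoint
    (locallyIntegrableOn_comp_add_right hΩ hu e)
  have hintegrable_sub := integrable_smul_of_tsupport_subset (hg.continuous.comp (by fun_prop))
    (hgc.comp_homeomorph (Homeomorph.subRight e)) (tsupport_comp_sub_right_subset hendpoint) hu
  have hderiv : Continuous fun x => fderiv ℝ g x e :=
    (hg.continuous_fderiv one_ne_zero).clm_apply continuous_const
  have hftc (y : E) : segmentAverage (fun x => fderiv ℝ g x e) (-e) y = -(g (y - e) - g y) := by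
    rw [sub_eq_add_neg y e, ← segmentAverage_fderiv hg (-e) y]
    simp [segmentAverage, integral_neg]
  calc ∫ x, g x • (u (x + e) - u x) ∂μ
      = (∫ x, g x • u (x + e) ∂μ) - ∫ x, g x • u x ∂μ := by
        simp only [smul_sub, integral_sub hintegrable_add hintegrable]
    _ = (∫ y, g (y - e) • u y ∂μ) - ∫ y, g y • u y ∂μ := by
        rw [← integral_sub_right_eq_self (fun x => g x • u (x + e)) e]
        simp only [sub_add_cancel]
    _ = ∫ y, (g (y - e) - g y) • u y ∂μ := by
        simp only [sub_smul]
        exact (integral_sub hintegrable_sub hintegrable).symm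
    _ = -∫ y, segmentAverage (fun x => fderiv ℝ g x e) (-e) y • u y ∂μ := by
        simp only [hftc, neg_smul, integral_neg, neg_neg]
    _ = -∫ x, fderiv ℝ g x e • segmentAverage u e x ∂μ := by
        rw [integral_smul_segmentAverage_eq_integral_segmentAverage_neg_smul hderiv
          (hgc.fderiv_apply ℝ e) ((tsupport_fderiv_apply_subset ℝ e).trans hge) hu]

theorem HasWeakLineDerivOn.integral_smul_increment_eq_integral_smul_segmentAverage
    [CompleteSpace F] (hΩ : IsOpen Ω) (huv : HasWeakLineDerivOn u v e Ω μ)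
    (hg : ContDiff ℝ (⊤ : ℕ∞) g) (hgc : HasCompactSupport g)
    (hge : tsupport g ⊆ segmentDomain Ω e) :
    ∫ x, g x • (u (x + e) - u x) ∂μ = ∫ x, g x • segmentAverage v e x ∂μ := by
  have hderiv : Continuous fun x => fderiv ℝ g x e :=
    (hg.continuous_fderiv (by simp)).clm_apply continuous_const
  calc ∫ x, g x • (u (x + e) - u x) ∂μ
      = -∫ x, fderiv ℝ g x e • segmentAverage u e x ∂μ :=
        integral_smul_increment_eq_neg_integral_fderiv_smul hΩ huv.locInt_fun
          (hg.of_le (by simp)) hgc hge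
    _ = -∫ s in Set.Icc (0 : ℝ) 1, ∫ x, fderiv ℝ g x e • u (x + s • e) ∂μ := by
        rw [integral_smul_segmentAverage_eq_integral_integral hderiv (hgc.fderiv_apply ℝ e)
          ((tsupport_fderiv_apply_subset ℝ e).trans hge) huv.locInt_fun]
    _ = ∫ s in Set.Icc (0 : ℝ) 1, ∫ x, g x • v (x + s • e) ∂μ := by
        rw [← integral_neg]
        refine setIntegral_congr_fun measurableSet_Icc fun s hs => ?_
        exact neg_eq_iff_eq_neg.2 ((huv.comp_add_right hΩ (s • e)).integral_eq g hg hgc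
          fun x hx => mem_segmentDomain_iff.1 (hge hx) s hs)
    _ = ∫ x, g x • segmentAverage v e x ∂μ :=
        (integral_smul_segmentAverage_eq_integral_integral hg.continuous hgc hge
          huv.locInt_deriv).symm

theorem HasWeakLineDerivOn.increment_ae_eq_segmentAverage [CompleteSpace F] (hΩ : IsOpen Ω)
    (huv : HasWeakLineDerivOn u v e Ω μ) :
    (fun x => u (x + e) - u x) =ᵐ[μ.restrict (segmentDomain Ω e)] segmentAverage v e := by
  have hendpoint : segmentDomain Ω e ⊆ (· + e) ⁻¹' Ω := fun x hx => hx (right_mem_segment ℝ x _)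
  exact ae_restrict_eq_of_forall_integral_smul_eq (isOpen_segmentDomain hΩ e)
    (((locallyIntegrableOn_comp_add_right hΩ huv.locInt_fun e).mono_set hendpoint).sub
      (huv.locInt_fun.mono_set segmentDomain_subset))
    (locallyIntegrableOn_segmentAverage hΩ huv.locInt_deriv e)
    fun g hg hgc hge => huv.integral_smul_increment_eq_integral_smul_segmentAverage hΩ hg hgc hge

end WeakDerivative

section DifferenceQuotient

variable {E F : Type*} [NormedAddCommGroup E] [NormedSpace ℝ E] [NormedAddCommGroup F]
  [NormedSpace ℝ F]

/-- The difference quotient of `u` with step `h` in the direction `e`, meaningful for `h ≠ 0`. It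
extends `diffQuot` to an arbitrary direction and to vector-valued functions. -/
noncomputable def diffQuotAlong (e : E) (h : ℝ) (u : E → F) (x : E) : F :=
  h⁻¹ • (u (x + h • e) - u x)

variable [FiniteDimensional ℝ E] [MeasurableSpace E] [BorelSpace E] [CompleteSpace F]
  {μ : Measure E} [μ.IsAddHaarMeasure] {Ω : Set E} {u v : E → F} {e : E} {p : ℝ≥0∞}

theorem HasWeakLineDerivOn.diffQuotAlong_ae_eq_segmentAverage (hΩ : IsOpen Ω)
    (huv : HasWeakLineDerivOn u v e Ω μ) {h : ℝ} (hh : h ≠ 0) :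
    diffQuotAlong e h u =ᵐ[μ.restrict (segmentDomain Ω (h • e))] segmentAverage v (h • e) := by
  filter_upwards [(huv.smul_direction h).increment_ae_eq_segmentAverage hΩ] with x hx
  simp only [diffQuotAlong, hx, segmentAverage, integral_smul, inv_smul_smul₀ hh]

theorem HasWeakLineDerivOn.eLpNorm_diffQuotAlong_le (hΩ : IsOpen Ω)
    (huv : HasWeakLineDerivOn u v e Ω μ) (hp : 1 ≤ p) {h : ℝ} (hh : h ≠ 0) :
    eLpNorm (diffQuotAlong e h u) p (μ.restrict (segmentDomain Ω (h • e))) ≤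
      eLpNorm v p (μ.restrict Ω) := by
  rw [eLpNorm_congr_ae (huv.diffQuotAlong_ae_eq_segmentAverage hΩ hh)]
  exact eLpNorm_restrict_segmentAverage_le hΩ huv.locInt_deriv.aestronglyMeasurable hp (h • e)

theorem HasWeakLineDerivOn.tendsto_eLpNorm_diffQuotAlong_sub (hΩ : IsOpen Ω)
    (huv : HasWeakLineDerivOn u v e Ω μ) (hv : MemLp v p (μ.restrict Ω)) (hp : 1 ≤ p)
    (hp_top : p ≠ ∞) :
    Tendsto (fun h : ℝ => eLpNorm (fun x => diffQuotAlong e h u x - v x) p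
      (μ.restrict (segmentDomain Ω (h • e)))) (𝓝[≠] 0) (𝓝 0) := by
  refine (((tendsto_eLpNorm_restrict_segmentAverage_sub hΩ hv hp hp_top).comp
    (tendsto_smul_const_nhds_zero e)).mono_left nhdsWithin_le_nhds).congr' ?_
  filter_upwards [self_mem_nhdsWithin] with h hh
  exact eLpNorm_congr_ae
    ((huv.diffQuotAlong_ae_eq_segmentAverage hΩ hh).symm.sub (ae_eq_refl v))

theorem HasWeakLineDerivOn.tendsto_eLpNorm_diffQuotAlong_sub_of_isCompact (hΩ : IsOpen Ω)
    (huv : HasWeakLineDerivOn u v e Ω μ) (hv : MemLp v p (μ.restrict Ω)) (hp : 1 ≤ p)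
    (hp_top : p ≠ ∞) {K : Set E} (hK : IsCompact K) (hKΩ : K ⊆ Ω) :
    Tendsto (fun h : ℝ => eLpNorm (fun x => diffQuotAlong e h u x - v x) p (μ.restrict K))
      (𝓝[≠] 0) (𝓝 0) := by
  refine tendsto_of_tendsto_of_tendsto_of_le_of_le' tendsto_const_nhds
    (huv.tendsto_eLpNorm_diffQuotAlong_sub hΩ hv hp hp_top)
    (Eventually.of_forall fun _ => zero_le) ?_
  filter_upwards [nhdsWithin_le_nhds (eventually_subset_segmentDomain_smul hΩ hK hKΩ e)] with h hh
  exact eLpNorm_mono_measure _ (Measure.restrict_mono_set μ hh)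

theorem HasWeakLineDerivOn.ae_tendsto_diffQuotAlong (hΩ : IsOpen Ω)
    (huv : HasWeakLineDerivOn u v e Ω μ) {h : ℕ → ℝ} (hh : Tendsto h atTop (𝓝[≠] 0)) :
    ∀ᵐ x ∂μ.restrict Ω, Tendsto (fun k => diffQuotAlong e (h k) u x) atTop (𝓝 (v x)) := by
  obtain ⟨hlim, hne⟩ := tendsto_nhdsWithin_iff.1 hh
  have hquot : ∀ᵐ x ∂μ, ∀ k, h k ≠ 0 → x ∈ segmentDomain Ω (h k • e) →
      diffQuotAlong e (h k) u x = segmentAverage v (h k • e) x :=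
    ae_all_iff.2 fun k => eventually_imp_distrib_left.2 fun hk =>
      (ae_restrict_iff' (isOpen_segmentDomain hΩ _).measurableSet).1
        (huv.diffQuotAlong_ae_eq_segmentAverage hΩ hk)
  filter_upwards [ae_restrict_tendsto_segmentAverage hΩ huv.locInt_deriv e hh,
    ae_restrict_of_ae hquot, ae_restrict_mem hΩ.measurableSet] with x hx hxk hxΩ
  refine hx.congr' ?_
  filter_upwards [hne, hlim.eventually (eventually_subset_segmentDomain_smul hΩ
    isCompact_singleton (Set.singleton_subset_iff.2 hxΩ) e)] with k hk hxD
  exact (hxk k hk (hxD rfl)).symm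

end DifferenceQuotient

section WeakPartial

variable {n : ℕ} {Ω : Opens (EuclideanSpace ℝ (Fin n))} {i : Fin n}
  {u v : EuclideanSpace ℝ (Fin n) → ℝ}

theorem diffQuot_eq_diffQuotAlong (i : Fin n) (h : ℝ) (u : EuclideanSpace ℝ (Fin n) → ℝ) :
    diffQuot i h u = diffQuotAlong (unitVec i) h u :=
  funext fun _ => div_eq_inv_mul _ _

theorem shiftDomain_eq_segmentDomain (Ω : Opens (EuclideanSpace ℝ (Fin n))) (i : Fin n) (h : ℝ) :
    shiftDomain Ω i h = segmentDomain Ω (h • unitVec i) :=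
  rfl

theorem IsWeakPartial.hasWeakLineDerivOn (hv : IsWeakPartial Ω i u v) :
    HasWeakLineDerivOn u v (unitVec i) Ω volume where
  locInt_fun := hv.locInt_fun
  locInt_deriv := hv.locInt_deriv
  integral_eq φ hφ hφc hφΩ := by
    have htest := hv.integral_eq ⟨φ, hφ, hφc, hφΩ⟩
    simp only [TestFunction.coe_mk, mul_comm (u _), mul_comm (v _)] at htest
    rwa [setIntegral_eq_integral_of_forall_compl_eq_zero fun x hx => by
        rw [image_eq_zero_of_notMem_tsupport fun hxφ =>
          hx (hφΩ (tsupport_fderiv_apply_subset ℝ (unitVec i) hxφ)), zero_mul],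
      setIntegral_eq_integral_of_forall_compl_eq_zero fun x hx => by
        rw [image_eq_zero_of_notMem_tsupport fun hxφ => hx (hφΩ hxφ), zero_mul]] at htest

theorem MemW12.memLp_weakPartial (hu : MemW12 Ω u) (hv : IsWeakPartial Ω i u v) :
    MemLp v 2 (volume.restrict (Ω : Set (EuclideanSpace ℝ (Fin n)))) := by
  obtain ⟨w, hw, hwL⟩ := hu.exists_weakPartial i
  exact hwL.ae_eq (hw.hasWeakLineDerivOn.ae_eq Ω.isOpen hv.hasWeakLineDerivOn)

end WeakPartial

theorem theorem4_general {E F : Type*} [NormedAddCommGroup E] [NormedSpace ℝ E]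
    [FiniteDimensional ℝ E] [MeasurableSpace E] [BorelSpace E] [NormedAddCommGroup F]
    [NormedSpace ℝ F] [CompleteSpace F] {μ : Measure E} [μ.IsAddHaarMeasure] {Ω : Set E}
    (hΩ : IsOpen Ω) {u v : E → F} {e : E} (huv : HasWeakLineDerivOn u v e Ω μ) {p : ℝ≥0∞}
    (hp : 1 ≤ p) :
    (∀ h : ℝ, h ≠ 0 →
      eLpNorm (diffQuotAlong e h u) p (μ.restrict (segmentDomain Ω (h • e))) ≤
        eLpNorm v p (μ.restrict Ω)) ∧
    (p ≠ ∞ → MemLp v p (μ.restrict Ω) →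
      Tendsto (fun h : ℝ => eLpNorm (fun x => diffQuotAlong e h u x - v x) p
        (μ.restrict (segmentDomain Ω (h • e)))) (𝓝[≠] 0) (𝓝 0) ∧
      ∀ K : Set E, IsCompact K → K ⊆ Ω →
        Tendsto (fun h : ℝ => eLpNorm (fun x => diffQuotAlong e h u x - v x) p (μ.restrict K))
          (𝓝[≠] 0) (𝓝 0)) ∧
    (∀ h : ℕ → ℝ, (∀ k, h k ≠ 0) → Tendsto h atTop (𝓝 0) →
      ∀ᵐ x ∂μ.restrict Ω, Tendsto (fun k => diffQuotAlong e (h k) u x) atTop (𝓝 (v x))) :=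
  ⟨fun _ hh => huv.eLpNorm_diffQuotAlong_le hΩ hp hh,
    fun hp_top hv => ⟨huv.tendsto_eLpNorm_diffQuotAlong_sub hΩ hv hp hp_top,
      fun _ hK hKΩ => huv.tendsto_eLpNorm_diffQuotAlong_sub_of_isCompact hΩ hv hp hp_top hK hKΩ⟩,
    fun _ h0 hh => huv.ae_tendsto_diffQuotAlong hΩ
      (tendsto_nhdsWithin_iff.2 ⟨hh, Eventually.of_forall h0⟩)⟩

theorem theorem4 {n : ℕ} (i : Fin n) :
    -- the whole space
    (∀ u v : EuclideanSpace ℝ (Fin n) → ℝ, MemW12 ⊤ u → IsWeakPartial ⊤ i u v →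
      (∀ h : ℝ, h ≠ 0 → eLpNorm (diffQuot i h u) 2 volume ≤ eLpNorm v 2 volume) ∧
      Tendsto (fun h : ℝ => eLpNorm (fun x => diffQuot i h u x - v x) 2 volume)
        (𝓝[≠] 0) (𝓝 0)) ∧
    -- an arbitrary open set
    (∀ (Ω : Opens (EuclideanSpace ℝ (Fin n))) (u v : EuclideanSpace ℝ (Fin n) → ℝ),
      MemW12 Ω u → IsWeakPartial Ω i u v →
      (∀ h : ℝ, h ≠ 0 →
        eLpNorm (diffQuot i h u) 2 (volume.restrict (shiftDomain Ω i h)) ≤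
          eLpNorm v 2 (volume.restrict (Ω : Set (EuclideanSpace ℝ (Fin n))))) ∧
      (∀ K : Set (EuclideanSpace ℝ (Fin n)), IsCompact K →
        K ⊆ (Ω : Set (EuclideanSpace ℝ (Fin n))) →
        Tendsto (fun h : ℝ => eLpNorm (fun x => diffQuot i h u x - v x) 2 (volume.restrict K))
          (𝓝[≠] 0) (𝓝 0)) ∧
      (∀ h : ℕ → ℝ, (∀ k, h k ≠ 0) → Tendsto h atTop (𝓝 0) →
        ∀ᵐ x ∂(volume.restrict (Ω : Set (EuclideanSpace ℝ (Fin n)))),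
          Tendsto (fun k => diffQuot i (h k) u x) atTop (𝓝 (v x)))) := by
  simp only [diffQuot_eq_diffQuotAlong, shiftDomain_eq_segmentDomain]
  refine ⟨fun u v hu hv => ?_, fun Ω u v hu hv => ?_⟩ <;>
    obtain ⟨hle, hlim, hae⟩ :=
      theorem4_general (Opens.isOpen _) hv.hasWeakLineDerivOn one_le_two <;>
    specialize hlim ENNReal.ofNat_ne_top (hu.memLp_weakPartial hv)
  · exact ⟨by simpa [segmentDomain_univ] using hle, by simpa [segmentDomain_univ] using hlim.1⟩
  · exact ⟨hle, hlim.2, hae⟩
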